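/- For a $d$-dimensional Euclidean space $E$ let $\hat f(\xi)=(2\pi)^{-d/2}\int_E e^{-ix\cdot\xi}f(x)\,dx$ (extended to $L^2(E)$ by Plancherel's theorem), and for $s>d$ let $H_s(E)$ be the space of $f\in L^2(E)$ with $\int_E|\hat f(\xi)|^2(1+|\xi|^2)^{s/2}\,d\xi<\infty$, with inner product $\langle f,g\rangle_s=\int_E\hat f(\xi)\overline{\hat g(\xi)}(1+|\xi|^2)^{s/2}\,d\xi$. Every $f\in H_s(E)$ is identified with its continuous representative (which exists, since $s>d$). The reproducing kernel of $H_s(E)$ is the family of continuous functions $d_y\in H_s(E)$, $y\in E$, with $f(y)=\langle f,d_y\rangle_s$ for all $f\in H_s(E)$. The statements below hold for the space of complex-valued functions and, likewise, for its subspace of real-valued functions; in both cases the kernel exists and is unique. (a) Let $n\ge 0$ and $s=n+3$. The reproducing kernel of $H_s(\mathbb R^n)$ is $$d_y(x)=C_n\,e^{-\|x-y\|}\,(1+\|x-y\|),\qquad C_n=\frac{1}{2^{n+1}\,\pi^{(n-1)/2}\,\Gamma\!\left(\frac{n+3}{2}\right)} .$$ (b) Let $A\ge 1$ be an integer. For all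 real $a\ge 0$, $$\frac1{2\pi}\int_{-\infty}^{\infty}e^{ia\xi}(1+\xi^2)^{-A}\,d\xi=P_A(a):=\frac{e^{-a}}{2^{A}(A-1)!}\sum_{k=0}^{A-1}\frac{(A+k-1)!}{k!\,(A-k-1)!}\,\frac{a^{A-1-k}}{2^{k}},$$ and the reproducing kernel of $H_{2A}(\mathbb R)$ is $d_y(x)=P_A(|x-y|)$. In particular $d_y(y)=\binom{2A-2}{A-1}2^{-2A+1}$. -/

import Mathlib

open MeasureTheory
open scoped FourierTransform ENNReal

noncomputable section

/-- The unitary Fourier transform in angular frequency of an `L²` function on a Euclidean space of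
dimension `n`, that is the Plancherel extension of
`f̂(ξ) = (2π)^(-n/2) ∫ exp(-i x·ξ) f(x) dx`.
Mathlib's `𝓕` is the (Plancherel extension of the) transform `∫ exp(-2πi x·η) f(x) dx`. -/
def angularFourier {E : Type*} [NormedAddCommGroup E] [InnerProductSpace ℝ E]
    [FiniteDimensional ℝ E] [MeasurableSpace E] [BorelSpace E]
    (f : Lp ℂ 2 (volume : Measure E)) (ξ : E) : ℂ :=
  (((2 * Real.pi) ^ (-(Module.finrank ℝ E : ℝ) / 2) : ℝ) : ℂ) *
    (𝓕 f : Lp ℂ 2 (volume : Measure E)) ((2 * Real.pi)⁻¹ • ξ)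

/-- Dilation by a nonzero factor preserves null sets. -/
theorem quasiMeasurePreserving_dilation {E : Type*} [NormedAddCommGroup E]
    [InnerProductSpace ℝ E] [FiniteDimensional ℝ E] [MeasurableSpace E] [BorelSpace E] :
    Measure.QuasiMeasurePreserving (fun ξ : E => (2 * Real.pi)⁻¹ • ξ) volume volume := by
  have hc : (2 * Real.pi)⁻¹ ≠ 0 := by positivity
  refine ⟨measurable_const_smul _, ?_⟩
  rw [Measure.map_addHaar_smul _ hc]
  exact Measure.smul_absolutelyContinuous

theorem aestronglyMeasurable_angularFourier {E : Type*} [NormedAddCommGroup E]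
    [InnerProductSpace ℝ E] [FiniteDimensional ℝ E] [MeasurableSpace E] [BorelSpace E]
    (f : Lp ℂ 2 (volume : Measure E)) :
    AEStronglyMeasurable (angularFourier f) volume :=
  ((Lp.aestronglyMeasurable (𝓕 f : Lp ℂ 2 (volume : Measure E))).comp_quasiMeasurePreserving
    quasiMeasurePreserving_dilation).const_mul _

theorem angularFourier_zero_ae {E : Type*} [NormedAddCommGroup E]
    [InnerProductSpace ℝ E] [FiniteDimensional ℝ E] [MeasurableSpace E] [BorelSpace E] :
    angularFourier (0 : Lp ℂ 2 (volume : Measure E)) =ᵐ[volume] 0 := by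
  have h : (𝓕 (0 : Lp ℂ 2 (volume : Measure E)) : Lp ℂ 2 (volume : Measure E)) = 0 :=
    (Lp.fourierTransformₗᵢ E ℂ).map_zero
  have h0 := quasiMeasurePreserving_dilation (E := E).ae_eq_comp
    (Lp.coeFn_zero ℂ 2 (volume : Measure E))
  filter_upwards [h0] with ξ hξ
  have hξ' : (0 : Lp ℂ 2 (volume : Measure E)) ((2 * Real.pi)⁻¹ • ξ) = 0 := hξ
  simp only [angularFourier, h, hξ', mul_zero, Pi.zero_apply]

theorem angularFourier_add_ae {E : Type*} [NormedAddCommGroup E]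
    [InnerProductSpace ℝ E] [FiniteDimensional ℝ E] [MeasurableSpace E] [BorelSpace E]
    (f g : Lp ℂ 2 (volume : Measure E)) :
    angularFourier (f + g) =ᵐ[volume] angularFourier f + angularFourier g := by
  have h : (𝓕 (f + g) : Lp ℂ 2 (volume : Measure E)) = 𝓕 f + 𝓕 g :=
    (Lp.fourierTransformₗᵢ E ℂ).map_add f g
  have h0 := quasiMeasurePreserving_dilation (E := E).ae_eq_comp
    (Lp.coeFn_add (𝓕 f : Lp ℂ 2 (volume : Measure E)) (𝓕 g))
  filter_upwards [h0] with ξ hξ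
  simp only [Function.comp_apply, Pi.add_apply] at hξ
  simp only [angularFourier, h, hξ, Pi.add_apply, mul_add]

theorem angularFourier_smul_ae {E : Type*} [NormedAddCommGroup E]
    [InnerProductSpace ℝ E] [FiniteDimensional ℝ E] [MeasurableSpace E] [BorelSpace E]
    (c : ℂ) (f : Lp ℂ 2 (volume : Measure E)) :
    angularFourier (c • f) =ᵐ[volume] c • angularFourier f := by
  have h : (𝓕 (c • f) : Lp ℂ 2 (volume : Measure E)) = c • 𝓕 f :=
    (Lp.fourierTransformₗᵢ E ℂ).map_smul c f
  have h0 := quasiMeasurePreserving_dilation (E := E).ae_eq_comp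
    (Lp.coeFn_smul c (𝓕 f : Lp ℂ 2 (volume : Measure E)))
  filter_upwards [h0] with ξ hξ
  simp only [Function.comp_apply, Pi.smul_apply, smul_eq_mul] at hξ
  simp only [angularFourier, h, hξ, Pi.smul_apply, smul_eq_mul]
  ring

/-- The Sobolev space `H_s` (for `s ≥ 0`) of complex-valued functions: the `L²` functions `f` with
`‖f‖_s² = ∫ |f̂(ξ)|² (1 + |ξ|²)^(s/2) dξ < ∞`. -/
def sobolevSpace (E : Type*) [NormedAddCommGroup E] [InnerProductSpace ℝ E]
    [FiniteDimensional ℝ E] [MeasurableSpace E] [BorelSpace E] (s : ℝ) :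
    Submodule ℂ (Lp ℂ 2 (volume : Measure E)) where
  carrier := {f | Integrable (fun ξ => ‖angularFourier f ξ‖ ^ 2 * (1 + ‖ξ‖ ^ 2) ^ (s / 2)) volume}
  zero_mem' := by
    refine (integrable_zero E ℝ volume).congr ?_
    filter_upwards [angularFourier_zero_ae (E := E)] with ξ hξ
    simp [hξ]
  add_mem' := by
    intro f g hf hg
    have hw : Continuous fun ξ : E => (1 + ‖ξ‖ ^ 2) ^ (s / 2) :=
      Continuous.rpow_const (by fun_prop) fun ξ => Or.inl (by positivity)
    refine ((hf.const_mul 2).add (hg.const_mul 2)).mono'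
      (((aestronglyMeasurable_angularFourier (f + g)).norm.pow 2).mul hw.aestronglyMeasurable) ?_
    filter_upwards [angularFourier_add_ae f g] with ξ hξ
    have hpos : 0 ≤ (1 + ‖ξ‖ ^ 2) ^ (s / 2) := by positivity
    rw [Real.norm_of_nonneg (by positivity), hξ]
    simp only [Pi.add_apply]
    have h1 := norm_add_le (angularFourier f ξ) (angularFourier g ξ)
    have h2 : ‖angularFourier f ξ + angularFourier g ξ‖ ^ 2 ≤
        2 * ‖angularFourier f ξ‖ ^ 2 + 2 * ‖angularFourier g ξ‖ ^ 2 := by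
      nlinarith [sq_nonneg (‖angularFourier f ξ‖ - ‖angularFourier g ξ‖),
        norm_nonneg (angularFourier f ξ + angularFourier g ξ)]
    nlinarith [mul_le_mul_of_nonneg_right h2 hpos]
  smul_mem' := by
    intro c f hf
    refine (Integrable.const_mul hf (‖c‖ ^ 2)).congr ?_
    filter_upwards [angularFourier_smul_ae c f] with ξ hξ
    rw [hξ]
    simp only [Pi.smul_apply, smul_eq_mul, norm_mul, mul_pow]
    ring

/-- The real-valued functions in `H_s`. -/
def realSobolevSpace (E : Type*) [NormedAddCommGroup E] [InnerProductSpace ℝ E]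
    [FiniteDimensional ℝ E] [MeasurableSpace E] [BorelSpace E] (s : ℝ) :
    Set (Lp ℂ 2 (volume : Measure E)) :=
  {f | f ∈ sobolevSpace E s ∧ ∀ᵐ x, (f x).im = 0}

/-- The inner product `⟨f, g⟩_s = ∫ f̂(ξ) conj(ĝ(ξ)) (1 + |ξ|²)^(s/2) dξ` of `H_s`. -/
def sobolevInner {E : Type*} [NormedAddCommGroup E] [InnerProductSpace ℝ E]
    [FiniteDimensional ℝ E] [MeasurableSpace E] [BorelSpace E] (s : ℝ)
    (f g : Lp ℂ 2 (volume : Measure E)) : ℂ :=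
  ∫ ξ, angularFourier f ξ * starRingEnd ℂ (angularFourier g ξ) *
    (((1 + ‖ξ‖ ^ 2) ^ (s / 2) : ℝ) : ℂ)

/-- `K` is the reproducing kernel of the space `V` of `L²` functions (which will be `H_s` or its
real part) for the inner product `⟨·, ·⟩_s`: for each `x`, the function `d_x = K x` is continuous
and its class `d` lies in `V`, every `f ∈ V` has a continuous representative `g` (unique, as
volume charges open sets), and the value of `f` at `x`, that is `g x`, is `⟨f, d_x⟩_s`. -/
def IsReproducingKernel {E : Type*} [NormedAddCommGroup E] [InnerProductSpace ℝ E]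
    [FiniteDimensional ℝ E] [MeasurableSpace E] [BorelSpace E] (s : ℝ)
    (V : Set (Lp ℂ 2 (volume : Measure E))) (K : E → E → ℂ) : Prop :=
  ∀ x : E, Continuous (K x) ∧ ∃ d ∈ V, d =ᵐ[volume] K x ∧
    ∀ f ∈ V, ∃ g : E → ℂ, Continuous g ∧ f =ᵐ[volume] g ∧ g x = sobolevInner s f d

end

/-! For `s > d` Cauchy–Schwarz makes `f̂` integrable for every `f` in `H_s`, so `f` has the
continuous representative `f(y) = (2π)^(-d/2) ∫ e^(iy·ξ) f̂(ξ) dξ`. Comparison with `⟨f, d_y⟩_s`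
forces `d̂_y(ξ) = (2π)^(-d/2) e^(-iy·ξ) (1 + |ξ|²)^(-s/2)`: the kernel is a translate of one inverse
Fourier transform (`IsReproducingKernel.of_fourierInv`). Uniqueness comes from evaluating two
kernels against each other (`IsReproducingKernel.eq_conj`).

To compute that transform, write `(1 + |ξ|²)^(-s/2)` as a Gamma integral of Gaussians and transform
each Gaussian (`fourierInv_besselSymbol`). Up to a constant the result is `∫₀^∞ t^(ν-1) exp(-t -
|z|²/(4t)) dt` with `ν = (s - d)/2`, so apart from the constant only `s - d` matters. Case (a) is `ν
= 3/2` in every dimension, and (b) is `ν = A - 1/2`. The values at `ν = 1/2` and `3/2` are read off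
on the line, from the elementary transforms of `e^(-|x|)` and `(1 + |x|) e^(-|x|)`. Integration by
parts gives a three-term recurrence in `ν`, which the polynomials of (b) also satisfy. -/

/-! ### The Plancherel inverse transform agrees with the inverse Fourier integral. -/

section FourierConsistency

theorem continuous_neg_innerₗ {E : Type*} [NormedAddCommGroup E] [InnerProductSpace ℝ E] :
    Continuous fun p : E × E => (-innerₗ E) p.1 p.2 := by
  simp only [LinearMap.neg_apply, innerₗ_apply_apply]
  fun_prop

variable {E : Type*} [NormedAddCommGroup E] [InnerProductSpace ℝ E]
    [FiniteDimensional ℝ E] [MeasurableSpace E] [BorelSpace E]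

theorem Real.continuous_fourierInv {h : E → ℂ} (hh : Integrable h) : Continuous (𝓕⁻ h) :=
  VectorFourier.fourierIntegral_continuous (L := -innerₗ E) Real.continuous_fourierChar
    continuous_neg_innerₗ hh

theorem Real.integral_fourierInv_smul_eq {g h : E → ℂ} (hg : Integrable g) (hh : Integrable h) :
    ∫ x, 𝓕⁻ g x • h x = ∫ x, g x • 𝓕⁻ h x := by
  have key := VectorFourier.integral_fourierIntegral_smul_eq_flip (L := -innerₗ E)
    (μ := volume) (ν := volume) Real.continuous_fourierChar
    continuous_neg_innerₗ hg hh
  have hflip : (-innerₗ E).flip = -innerₗ E := by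
    ext x y
    simp [real_inner_comm]
  rw [hflip] at key
  exact key

/-- Both sides have the same integral against every test function: the `L²` transform is compatible
with that of tempered distributions, and the integral transform can be moved onto the test function
by Fubini. -/
theorem MeasureTheory.Lp.fourierInv_ae_eq_of_integrable (h : Lp ℂ 2 (volume : Measure E))
    (hh : Integrable h) :
    (𝓕⁻ h : Lp ℂ 2 (volume : Measure E)) =ᵐ[volume] 𝓕⁻ (h : E → ℂ) := by
  refine ae_eq_of_integral_contDiff_smul_eq
    ((Lp.memLp _).locallyIntegrable (by norm_num))
    ((Real.continuous_fourierInv hh).locallyIntegrable) fun g hg hsupp => ?_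
  have hsupp' : HasCompactSupport (fun x => (g x : ℂ)) :=
    hsupp.comp_left (g := fun r : ℝ => (r : ℂ)) Complex.ofReal_zero
  have hg' : ContDiff ℝ ((⊤ : ℕ∞) : WithTop ℕ∞) (fun x => (g x : ℂ)) := Complex.ofRealCLM.contDiff.comp hg
  set φ : SchwartzMap E ℂ := hsupp'.toSchwartzMap hg' with hφ
  have hφx : ∀ x, φ x = (g x : ℂ) := fun x => rfl
  have h1 := congrArg (fun T => T φ) (Lp.fourierInv_toTemperedDistribution_eq h)
  simp only [TemperedDistribution.fourierInv_apply, Lp.toTemperedDistribution_apply] at h1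
  have h2 := Real.integral_fourierInv_smul_eq (φ.integrable (μ := volume)) hh
  rw [← SchwartzMap.fourierInv_coe] at h2
  rw [h2] at h1
  simpa [hφx] using h1.symm

end FourierConsistency

/-! ### The reproducing kernel as an inverse Fourier transform. -/

section ReproducingKernel

section Symbol

variable {E : Type*} [NormedAddCommGroup E] [InnerProductSpace ℝ E]

/-- The symbol `(1 + |ξ|²)^(-s/2)` in the frequency variable `η = ξ / 2π`. -/
noncomputable def besselSymbol (s : ℝ) (η : E) : ℝ :=
  (1 + ‖(2 * Real.pi) • η‖ ^ 2) ^ (-(s / 2))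

theorem besselSymbol_nonneg (s : ℝ) (η : E) : 0 ≤ besselSymbol s η := by
  unfold besselSymbol; positivity

theorem besselSymbol_le_one {s : ℝ} (hs : 0 ≤ s) (η : E) : besselSymbol s η ≤ 1 :=
  Real.rpow_le_one_of_one_le_of_nonpos (by nlinarith [sq_nonneg ‖(2 * Real.pi) • η‖]) (by linarith)

theorem besselSymbol_dilation (s : ℝ) (ξ : E) :
    besselSymbol s ((2 * Real.pi)⁻¹ • ξ) = (1 + ‖ξ‖ ^ 2) ^ (-(s / 2)) := by
  have : 2 * Real.pi ≠ 0 := by positivity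
  rw [besselSymbol, smul_inv_smul₀ this]

theorem continuous_besselSymbol (s : ℝ) : Continuous (besselSymbol s : E → ℝ) := by
  unfold besselSymbol
  exact Continuous.rpow_const (by fun_prop) fun ξ => Or.inl (by positivity)

theorem one_add_norm_sq_rpow_neg_mul {E : Type*} [SeminormedAddCommGroup E] (s : ℝ) (ξ : E) :
    (1 + ‖ξ‖ ^ 2) ^ (-(s / 2)) * (1 + ‖ξ‖ ^ 2) ^ (s / 2) = 1 := by
  rw [← Real.rpow_add (by positivity), neg_add_cancel, Real.rpow_zero]

/-- The Fourier transform of the kernel function centred at `x`. -/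
noncomputable def kernelSymbol (s : ℝ) (x η : E) : ℂ :=
  (Real.fourierChar (-(inner ℝ η x)) : ℂ) * besselSymbol s η

theorem norm_kernelSymbol (s : ℝ) (x η : E) : ‖kernelSymbol s x η‖ = besselSymbol s η := by
  rw [kernelSymbol, norm_mul, Circle.norm_coe, one_mul, Complex.norm_real,
    Real.norm_of_nonneg (besselSymbol_nonneg s η)]

theorem continuous_kernelSymbol (s : ℝ) (x : E) : Continuous (kernelSymbol s x) := by
  unfold kernelSymbol
  have h1 := continuous_besselSymbol (E := E) s
  have h2 := Real.continuous_fourierChar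
  fun_prop

end Symbol

variable {E : Type*} [NormedAddCommGroup E] [InnerProductSpace ℝ E]
    [FiniteDimensional ℝ E] [MeasurableSpace E] [BorelSpace E]

theorem sobolevInner_conj (s : ℝ) (f g : Lp ℂ 2 (volume : Measure E)) :
    sobolevInner s f g = starRingEnd ℂ (sobolevInner s g f) := by
  unfold sobolevInner
  rw [← integral_conj]
  refine integral_congr_ae (.of_forall fun ξ => ?_)
  simp only [map_mul, Complex.conj_conj, Complex.conj_ofReal]
  ring

/-- Two reproducing kernels of the same space agree up to the Hermitian symmetry. -/
theorem IsReproducingKernel.eq_conj {s : ℝ} {V : Set (Lp ℂ 2 (volume : Measure E))}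
    {K L : E → E → ℂ} (hK : IsReproducingKernel s V K) (hL : IsReproducingKernel s V L)
    (x y : E) : K x y = starRingEnd ℂ (L y x) := by
  obtain ⟨hKc, d, hd, hdK, hdr⟩ := hK x
  obtain ⟨hLc, e, he, heL, her⟩ := hL y
  -- Each kernel function is evaluated by the other kernel: `K x y = ⟨d, e⟩_s` and `L y x = ⟨e,
  -- d⟩_s`. Continuity upgrades a.e. equality of representatives to equality.
  obtain ⟨g, hg, hdg, hgy⟩ := her d hd
  obtain ⟨h, hh, heh, hhx⟩ := hdr e he
  have h1 : K x = g := (hKc.ae_eq_iff_eq volume hg).1 (hdK.symm.trans hdg)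
  have h2 : L y = h := (hLc.ae_eq_iff_eq volume hh).1 (heL.symm.trans heh)
  rw [h1, hgy, h2, hhx, ← sobolevInner_conj]

/-- A real kernel depending on the distance only is the unique reproducing kernel as soon as it is
one. -/
theorem isReproducingKernel_iff_of_radial {s : ℝ} {V : Set (Lp ℂ 2 (volume : Measure E))}
    {κ : ℝ → ℝ} (hκ : IsReproducingKernel s V fun y x => (κ ‖x - y‖ : ℂ)) (K : E → E → ℂ) :
    IsReproducingKernel s V K ↔ ∀ y x, K y x = (κ ‖x - y‖ : ℂ) := by
  refine ⟨fun hK y x => ?_, fun h => ?_⟩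
  · rw [hK.eq_conj hκ y x, Complex.conj_ofReal, norm_sub_rev]
  · have : K = fun y x => (κ ‖x - y‖ : ℂ) := by
      funext y x
      exact h y x
    rwa [this]

theorem integrable_besselSymbol {s : ℝ} (hs : (Module.finrank ℝ E : ℝ) < s) :
    Integrable (besselSymbol s : E → ℝ) := by
  have h := (integrable_rpow_neg_one_add_norm_sq (μ := (volume : Measure E)) hs).comp_smul
    (show 2 * Real.pi ≠ 0 by positivity)
  simpa only [neg_div] using! h

theorem integrable_kernelSymbol {s : ℝ} (hs : (Module.finrank ℝ E : ℝ) < s) (x : E) :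
    Integrable (kernelSymbol s x) :=
  (integrable_besselSymbol hs).mono' (continuous_kernelSymbol s x).aestronglyMeasurable
    (.of_forall fun η => (norm_kernelSymbol s x η).le)

theorem memLp_kernelSymbol {s : ℝ} (hs : (Module.finrank ℝ E : ℝ) < s) (x : E) :
    MemLp (kernelSymbol s x) 2 volume := by
  have hs0 : 0 ≤ s := (Nat.cast_nonneg _).trans hs.le
  refine (memLp_two_iff_integrable_sq_norm (continuous_kernelSymbol s x).aestronglyMeasurable).2
    ((integrable_besselSymbol hs).mono'
      ((continuous_kernelSymbol s x).norm.pow 2).aestronglyMeasurable (.of_forall fun η => ?_))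
  rw [Real.norm_of_nonneg (by positivity), norm_kernelSymbol]
  nlinarith [besselSymbol_nonneg s η, besselSymbol_le_one hs0 η]

/-- The kernel function centred at `x`, as an `L²` class. -/
noncomputable def kernelFun {s : ℝ} (hs : (Module.finrank ℝ E : ℝ) < s) (x : E) :
    Lp ℂ 2 (volume : Measure E) :=
  𝓕⁻ (memLp_kernelSymbol hs x).toLp

theorem kernelFun_ae_eq {s : ℝ} (hs : (Module.finrank ℝ E : ℝ) < s) (x : E) :
    kernelFun hs x =ᵐ[volume] 𝓕⁻ (kernelSymbol s x) := by
  have h0 := (memLp_kernelSymbol hs x).coeFn_toLp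
  refine (Lp.fourierInv_ae_eq_of_integrable _
    ((integrable_kernelSymbol hs x).congr h0.symm)).trans (.of_forall fun y => ?_)
  exact Real.fourierInv_congr_ae h0 y

/-- Modulation in frequency is translation in space. -/
theorem fourierInv_kernelSymbol (s : ℝ) (x y : E) :
    𝓕⁻ (kernelSymbol s x) y = 𝓕⁻ (fun η : E => (besselSymbol s η : ℂ)) (y - x) := by
  rw [Real.fourierInv_eq, Real.fourierInv_eq]
  congr 1
  funext η
  rw [Circle.smul_def, Circle.smul_def, kernelSymbol, smul_eq_mul, smul_eq_mul, ← mul_assoc,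
    ← Circle.coe_mul, ← AddChar.map_add_eq_mul, inner_sub_right, sub_eq_add_neg]

theorem angularFourier_kernelFun_ae {s : ℝ} (hs : (Module.finrank ℝ E : ℝ) < s) (x : E) :
    angularFourier (kernelFun hs x) =ᵐ[volume] fun ξ =>
      (((2 * Real.pi) ^ (-(Module.finrank ℝ E : ℝ) / 2) : ℝ) : ℂ) *
        kernelSymbol s x ((2 * Real.pi)⁻¹ • ξ) := by
  have h : 𝓕 (kernelFun hs x) = (memLp_kernelSymbol hs x).toLp :=
    FourierTransform.fourier_fourierInv_eq _
  have h0 := quasiMeasurePreserving_dilation (E := E).ae_eq_comp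
    (memLp_kernelSymbol hs x).coeFn_toLp
  filter_upwards [h0] with ξ hξ
  simp only [Function.comp_apply] at hξ
  simp only [angularFourier, h, hξ]

theorem kernelFun_mem_sobolevSpace {s : ℝ} (hs : (Module.finrank ℝ E : ℝ) < s) (x : E) :
    kernelFun hs x ∈ sobolevSpace E s := by
  change Integrable _ _
  have h := (integrable_rpow_neg_one_add_norm_sq (μ := (volume : Measure E)) hs).const_mul
    (((2 * Real.pi) ^ (-(Module.finrank ℝ E : ℝ) / 2)) ^ 2)
  refine h.congr ?_
  filter_upwards [angularFourier_kernelFun_ae hs x] with ξ hξ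
  rw [hξ, norm_mul, norm_kernelSymbol, besselSymbol_dilation, Complex.norm_real,
    Real.norm_of_nonneg (by positivity), mul_pow, mul_assoc, sq ((1 + ‖ξ‖ ^ 2) ^ (-(s / 2))),
    mul_assoc, one_add_norm_sq_rpow_neg_mul, mul_one, neg_div 2 s]

theorem integrable_angularFourier {s : ℝ} (hs : (Module.finrank ℝ E : ℝ) < s)
    {f : Lp ℂ 2 (volume : Measure E)} (hf : f ∈ sobolevSpace E s) :
    Integrable (angularFourier f) := by
  have hf' : Integrable fun ξ => ‖angularFourier f ξ‖ ^ 2 * (1 + ‖ξ‖ ^ 2) ^ (s / 2) := hf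
  refine (hf'.add (integrable_rpow_neg_one_add_norm_sq (μ := (volume : Measure E)) hs)).mono'
    (aestronglyMeasurable_angularFourier f) (.of_forall fun ξ => ?_)
  have h1 := one_add_norm_sq_rpow_neg_mul s ξ
  have h2 : 0 < (1 + ‖ξ‖ ^ 2) ^ (s / 2) := by positivity
  have h3 : 0 < (1 + ‖ξ‖ ^ 2) ^ (-(s / 2)) := by positivity
  simp only [Pi.add_apply, neg_div]
  set a := ‖angularFourier f ξ‖
  set w := (1 + ‖ξ‖ ^ 2) ^ (s / 2)
  set v := (1 + ‖ξ‖ ^ 2) ^ (-(s / 2))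
  have ha : 0 ≤ a := norm_nonneg _
  -- Cauchy–Schwarz in pointwise form: since `v * w = 1`, `2a ≤ a²w + v`, and both terms on the
  -- right are integrable.
  have h4 : a ^ 2 * w + v - 2 * a = v * (a * w - 1) ^ 2 := by
    linear_combination (-(a ^ 2 * w) + 2 * a) * h1
  have h5 : 0 ≤ v * (a * w - 1) ^ 2 := by positivity
  linarith

theorem integrable_fourier_of_mem_sobolevSpace {s : ℝ} (hs : (Module.finrank ℝ E : ℝ) < s)
    {f : Lp ℂ 2 (volume : Measure E)} (hf : f ∈ sobolevSpace E s) :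
    Integrable (𝓕 f : Lp ℂ 2 (volume : Measure E)) := by
  have hc : (((2 * Real.pi) ^ (-(Module.finrank ℝ E : ℝ) / 2) : ℝ) : ℂ) ≠ 0 :=
    Complex.ofReal_ne_zero.2 (by positivity)
  rw [← integrable_comp_smul_iff volume _ (show (2 * Real.pi)⁻¹ ≠ 0 by positivity)]
  refine ((integrable_angularFourier hs hf).const_mul
    (((2 * Real.pi) ^ (-(Module.finrank ℝ E : ℝ) / 2) : ℝ) : ℂ)⁻¹).congr
    (.of_forall fun ξ => ?_)
  exact inv_mul_cancel_left₀ hc _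

/-- The weight cancels the symbol and leaves the inverse Fourier integral at `x`. The two factors
`(2π)^(-d/2)` cancel the Jacobian `(2π)^d` of `ξ = 2πη`. -/
theorem sobolevInner_kernelFun {s : ℝ} (hs : (Module.finrank ℝ E : ℝ) < s)
    (f : Lp ℂ 2 (volume : Measure E)) (x : E) :
    sobolevInner s f (kernelFun hs x) = 𝓕⁻ ((𝓕 f : Lp ℂ 2 (volume : Measure E)) : E → ℂ) x := by
  set d : ℝ := (Module.finrank ℝ E : ℝ) with hd
  set c : ℝ := (2 * Real.pi) ^ (-d / 2) with hc
  set F : E → ℂ := ((𝓕 f : Lp ℂ 2 (volume : Measure E)) : E → ℂ) with hF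
  have hcc : c * c * (2 * Real.pi) ^ Module.finrank ℝ E = 1 := by
    rw [hc, ← Real.rpow_add (by positivity), ← Real.rpow_natCast, ← Real.rpow_add (by positivity),
      ← hd]
    convert! Real.rpow_zero _ using 2
    ring
  have h1 : sobolevInner s f (kernelFun hs x) = ∫ ξ : E,
      (fun η : E => ((c * c : ℝ) : ℂ) * (Real.fourierChar (inner ℝ η x) • F η))
        ((2 * Real.pi)⁻¹ • ξ) := by
    refine integral_congr_ae ?_
    filter_upwards [angularFourier_kernelFun_ae hs x] with ξ hξ
    have hw := one_add_norm_sq_rpow_neg_mul s ξ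
    have hw' : (((1 + ‖ξ‖ ^ 2) ^ (-(s / 2)) : ℝ) : ℂ) * (((1 + ‖ξ‖ ^ 2) ^ (s / 2) : ℝ) : ℂ) = 1 := by
      exact_mod_cast hw
    rw [hξ]
    simp only [angularFourier, kernelSymbol, map_mul, Complex.conj_ofReal, besselSymbol_dilation,
      Circle.smul_def, smul_eq_mul, AddChar.map_neg_eq_inv, Circle.coe_inv_eq_conj,
      Complex.conj_conj, ← hd, ← hc, ← hF, Complex.ofReal_mul]
    linear_combination ((c : ℂ) * F ((2 * Real.pi)⁻¹ • ξ) * c *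
      (Real.fourierChar (inner ℝ ((2 * Real.pi)⁻¹ • ξ) x) : ℂ)) * hw'
  have h2 := Measure.integral_comp_smul (volume : Measure E)
    (fun η : E => ((c * c : ℝ) : ℂ) * (Real.fourierChar (inner ℝ η x) • F η)) (2 * Real.pi)⁻¹
  rw [h1, h2, integral_const_mul, Real.fourierInv_eq, inv_pow, inv_inv,
    abs_of_pos (by positivity), Complex.real_smul, ← mul_assoc, ← Complex.ofReal_mul,
    mul_comm _ (c * c), hcc, Complex.ofReal_one, one_mul]

/-- Stated for any `V` inside `H_s` that contains the kernel functions, so that it serves both the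
complex space and its real part. -/
theorem IsReproducingKernel.of_fourierInv {s : ℝ} (hs : (Module.finrank ℝ E : ℝ) < s)
    {V : Set (Lp ℂ 2 (volume : Measure E))} (hV : V ⊆ sobolevSpace E s) {K : E → E → ℂ}
    (hmem : ∀ x, kernelFun hs x ∈ V)
    (hK : ∀ x y, K x y = 𝓕⁻ (fun η : E => (besselSymbol s η : ℂ)) (y - x)) :
    IsReproducingKernel s V K := by
  intro x
  have hKx : K x = 𝓕⁻ (kernelSymbol s x) := by
    funext y
    rw [hK, fourierInv_kernelSymbol]
  refine ⟨hKx ▸ Real.continuous_fourierInv (integrable_kernelSymbol hs x), kernelFun hs x, hmem x,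
    hKx ▸ kernelFun_ae_eq hs x, fun f hf => ?_⟩
  have hF := integrable_fourier_of_mem_sobolevSpace hs (hV hf)
  refine ⟨_, Real.continuous_fourierInv hF, ?_, (sobolevInner_kernelFun hs f x).symm⟩
  have h := Lp.fourierInv_ae_eq_of_integrable _ hF
  rwa [FourierTransform.fourierInv_fourier_eq] at h

theorem isReproducingKernel_sobolevSpace_iff {s : ℝ} (hs : (Module.finrank ℝ E : ℝ) < s)
    {κ : ℝ → ℝ} (hκ : ∀ z : E, 𝓕⁻ (fun η : E => (besselSymbol s η : ℂ)) z = κ ‖z‖)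
    (K : E → E → ℂ) :
    IsReproducingKernel s (sobolevSpace E s : Set _) K ↔ ∀ y x, K y x = (κ ‖x - y‖ : ℂ) :=
  isReproducingKernel_iff_of_radial (.of_fourierInv hs subset_rfl
    (kernelFun_mem_sobolevSpace hs) fun _ _ => (hκ _).symm) K

theorem isReproducingKernel_realSobolevSpace_iff {s : ℝ} (hs : (Module.finrank ℝ E : ℝ) < s)
    {κ : ℝ → ℝ} (hκ : ∀ z : E, 𝓕⁻ (fun η : E => (besselSymbol s η : ℂ)) z = κ ‖z‖)
    (K : E → E → ℂ) :
    IsReproducingKernel s (realSobolevSpace E s) K ↔ ∀ y x, K y x = (κ ‖x - y‖ : ℂ) := by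
  refine isReproducingKernel_iff_of_radial (.of_fourierInv hs (fun f hf => hf.1)
    (fun x => And.intro (kernelFun_mem_sobolevSpace hs x) ?_) fun _ _ => (hκ _).symm) K
  -- The kernel functions lie in the real part because `κ` is real-valued.
  filter_upwards [kernelFun_ae_eq hs x] with y hy
  rw [hy, fourierInv_kernelSymbol, hκ, Complex.ofReal_im]

end ReproducingKernel

/-! ### Writing the kernel as an integral of Gaussians. -/

section Subordination

/-- The integral `∫₀^∞ t^(ν-1) exp(-t - c/t) dt`. -/
noncomputable def subordinationIntegral (ν c : ℝ) : ℝ :=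
  ∫ t in Set.Ioi (0 : ℝ), t ^ (ν - 1) * Real.exp (-t - c / t)

theorem Real.integrableOn_rpow_mul_exp_neg_mul_Ioi {a r : ℝ} (ha : 0 < a) (hr : 0 < r) :
    IntegrableOn (fun t : ℝ => t ^ (a - 1) * Real.exp (-(r * t))) (Set.Ioi 0) := by
  -- The Bochner integral of a non-integrable function is `0`, so a nonzero value proves
  -- integrability.
  refine .of_integral_ne_zero ?_
  rw [Real.integral_rpow_mul_exp_neg_mul_Ioi ha hr]
  have := Real.Gamma_pos_of_pos ha
  positivity

theorem integrableOn_subordinationIntegral {ν c : ℝ} (hν : 0 < ν) (hc : 0 ≤ c) :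
    IntegrableOn (fun t : ℝ => t ^ (ν - 1) * Real.exp (-t - c / t)) (Set.Ioi 0) := by
  refine (Real.integrableOn_rpow_mul_exp_neg_mul_Ioi hν one_pos).mono'
    (Measurable.aestronglyMeasurable (by fun_prop)) ?_
  filter_upwards [self_mem_ae_restrict measurableSet_Ioi] with t ht
  have ht' : 0 < t := ht
  rw [Real.norm_of_nonneg (by positivity)]
  gcongr
  have : 0 ≤ c / t := by positivity
  linarith

/-- Integration by parts. -/
theorem subordinationIntegral_add_one {ν c : ℝ} (hν : 1 < ν) (hc : 0 ≤ c) :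
    subordinationIntegral (ν + 1) c =
      ν * subordinationIntegral ν c + c * subordinationIntegral (ν - 1) c := by
  have i1 := integrableOn_subordinationIntegral (ν := ν + 1) (by linarith) hc
  have i2 := (integrableOn_subordinationIntegral (ν := ν) (by linarith) hc).const_mul ν
  have i3 := (integrableOn_subordinationIntegral (ν := ν - 1) (by linarith) hc).const_mul c
  have hν0 : ν ≠ 0 := by linarith
  have bound : ∀ t : ℝ, 0 ≤ t → ‖t ^ ν * Real.exp (-t - c / t)‖ ≤ t ^ ν * Real.exp (-1 * t) := by
    intro t ht
    have : 0 ≤ c / t := by positivity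
    rw [Real.norm_of_nonneg (by positivity)]
    gcongr
    linarith
  -- The function `t^ν exp(-t - c/t)` tends to `0` at both ends, so its derivative integrates to
  -- `0`; the three terms of the derivative are the three integrals.
  have key := integral_Ioi_of_hasDerivAt_of_tendsto (a := 0) (m := 0)
    (f := fun t : ℝ => t ^ ν * Real.exp (-t - c / t))
    (f' := fun t => (ν * (t ^ (ν - 1) * Real.exp (-t - c / t)) +
      c * (t ^ (ν - 1 - 1) * Real.exp (-t - c / t))) - t ^ (ν + 1 - 1) * Real.exp (-t - c / t))
    ?_ ?_ ((i2.add i3).sub i1) ?_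
  · have i23 : Integrable (fun t => ν * (t ^ (ν - 1) * Real.exp (-t - c / t)) +
        c * (t ^ (ν - 1 - 1) * Real.exp (-t - c / t))) (volume.restrict (Set.Ioi 0)) := i2.add i3
    rw [integral_sub i23 i1, integral_add i2 i3, integral_const_mul, integral_const_mul,
      Real.zero_rpow hν0, zero_mul, sub_zero, sub_eq_zero] at key
    exact key.symm
  · rw [ContinuousWithinAt, Real.zero_rpow hν0, zero_mul]
    refine squeeze_zero_norm' (a := fun t : ℝ => t ^ ν * Real.exp (-1 * t)) ?_ ?_
    · filter_upwards [self_mem_nhdsWithin] with t ht using bound t ht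
    · have : Continuous fun t : ℝ => t ^ ν * Real.exp (-1 * t) :=
        (Real.continuous_rpow_const (by linarith)).mul (by fun_prop)
      have h := this.tendsto 0
      simp only [Real.zero_rpow hν0, zero_mul] at h
      exact h.mono_left nhdsWithin_le_nhds
  · intro t ht
    have ht' : (0 : ℝ) < t := ht
    have h1 := Real.hasDerivAt_rpow_const (x := t) (p := ν) (Or.inl ht'.ne')
    have h2 : HasDerivAt (fun t : ℝ => Real.exp (-t - c / t))
        (Real.exp (-t - c / t) * (-1 + c / t ^ 2)) t := by
      refine HasDerivAt.exp ?_
      have := (hasDerivAt_id t).neg.sub ((hasDerivAt_inv ht'.ne').const_mul c)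
      convert! this using 1
      ring
    convert! h1.mul h2 using 1
    have e1 : t ^ (ν - 1 - 1) = t ^ ν / t ^ 2 := by
      rw [sub_sub, one_add_one_eq_two, Real.rpow_sub ht', Real.rpow_two]
    rw [e1, add_sub_cancel_right]
    field_simp
    ring
  · refine squeeze_zero_norm' (a := fun t : ℝ => t ^ ν * Real.exp (-1 * t)) ?_
      (tendsto_rpow_mul_exp_neg_mul_atTop_nhds_zero ν 1 one_pos)
    filter_upwards [Filter.eventually_ge_atTop 0] with t ht using bound t ht

theorem besselSymbol_eq_integral {E : Type*} [NormedAddCommGroup E] [InnerProductSpace ℝ E]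
    {s : ℝ} (hs : 0 < s) (η : E) :
    Real.Gamma (s / 2) * besselSymbol s η = ∫ t in Set.Ioi (0 : ℝ),
      t ^ (s / 2 - 1) * Real.exp (-((1 + ‖(2 * Real.pi) • η‖ ^ 2) * t)) := by
  rw [Real.integral_rpow_mul_exp_neg_mul_Ioi (by positivity) (by positivity), besselSymbol,
    Real.rpow_neg (by positivity), one_div, Real.inv_rpow (by positivity), mul_comm]

variable {E : Type*} [NormedAddCommGroup E] [InnerProductSpace ℝ E]
    [FiniteDimensional ℝ E] [MeasurableSpace E] [BorelSpace E]

theorem fourierInv_gaussian_dilation {t : ℝ} (ht : 0 < t) (z : E) :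
    𝓕⁻ (fun η : E => (Real.exp (-(‖(2 * Real.pi) • η‖ ^ 2 * t)) : ℂ)) z =
      (((4 * Real.pi) ^ (-(Module.finrank ℝ E / 2 : ℝ)) * t ^ (-(Module.finrank ℝ E / 2 : ℝ)) *
        Real.exp (-(‖z‖ ^ 2 / 4) / t) : ℝ) : ℂ) := by
  have hb : 0 < ((4 * Real.pi ^ 2 * t : ℝ) : ℂ).re := by
    rw [Complex.ofReal_re]; positivity
  have h := fourier_gaussian_innerProductSpace hb (-z)
  rw [← Real.fourierInv_eq_fourier_neg] at h
  have hπ : (Real.pi : ℂ) ≠ 0 := Complex.ofReal_ne_zero.2 Real.pi_ne_zero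
  have ht' : (t : ℂ) ≠ 0 := Complex.ofReal_ne_zero.2 ht.ne'
  have hfun : (fun η : E => (Real.exp (-(‖(2 * Real.pi) • η‖ ^ 2 * t)) : ℂ)) =
      fun η => Complex.exp (-((4 * Real.pi ^ 2 * t : ℝ) : ℂ) * ‖η‖ ^ 2) := by
    funext η
    rw [norm_smul, Real.norm_of_nonneg (by positivity)]
    push_cast
    congr 1
    ring
  rw [hfun, h]
  symm
  · have h1 : (Real.pi : ℂ) / ((4 * Real.pi ^ 2 * t : ℝ) : ℂ) = (((4 * Real.pi * t)⁻¹ : ℝ) : ℂ) := by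
      push_cast
      field_simp
    have h2 : ((Module.finrank ℝ E : ℂ) / 2) = ((Module.finrank ℝ E / 2 : ℝ) : ℂ) := by
      push_cast; rfl
    rw [h1, h2, ← Complex.ofReal_cpow (by positivity), Real.inv_rpow (by positivity),
      ← Real.rpow_neg (by positivity), Real.mul_rpow (by positivity) ht.le, norm_neg]
    push_cast
    congr 2
    field_simp

/-- Subordination of the Bessel potential to the Gaussians. -/
theorem fourierInv_besselSymbol {s : ℝ} (hs : (Module.finrank ℝ E : ℝ) < s) (z : E) :
    𝓕⁻ (fun η : E => (besselSymbol s η : ℂ)) z =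
      (((4 * Real.pi) ^ (-(Module.finrank ℝ E / 2 : ℝ)) / Real.Gamma (s / 2) *
        subordinationIntegral (s / 2 - Module.finrank ℝ E / 2) (‖z‖ ^ 2 / 4) : ℝ) : ℂ) := by
  have hs0 : 0 < s := (Nat.cast_nonneg _).trans_lt hs
  have hΓ : 0 < Real.Gamma (s / 2) := Real.Gamma_pos_of_pos (by positivity)
  set d : ℝ := (Module.finrank ℝ E : ℝ) with hd
  let k : E → ℝ → ℝ := fun η t =>
    t ^ (s / 2 - 1) * Real.exp (-((1 + ‖(2 * Real.pi) • η‖ ^ 2) * t))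
  have hk0 : ∀ η, ∀ t ∈ Set.Ioi (0 : ℝ), 0 ≤ k η t := fun η t ht => by
    have : (0 : ℝ) < t := ht
    positivity
  have hkint : ∀ η, IntegrableOn (k η) (Set.Ioi 0) := fun η =>
    Real.integrableOn_rpow_mul_exp_neg_mul_Ioi (by positivity) (by positivity)
  let G : E → ℝ → ℂ := fun η t => Real.fourierChar (inner ℝ η z) • (k η t : ℂ)
  have hmeas : Measurable (Function.uncurry G) := by
    simp only [G, k, Function.uncurry_def, Circle.smul_def, smul_eq_mul]
    refine Measurable.mul ?_ (Complex.measurable_ofReal.comp (by fun_prop))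
    have h1 := Real.continuous_fourierChar
    exact (show Continuous fun p : E × ℝ => (Real.fourierChar (inner ℝ p.1 z) : ℂ) by
      fun_prop).measurable
  -- Fubini applies: integrating `‖G η t‖` over `t` gives `Γ(s/2)` times the symbol, which is
  -- integrable since `s > d`.
  have hG : Integrable (Function.uncurry G) (volume.prod (volume.restrict (Set.Ioi (0 : ℝ)))) := by
    refine (integrable_prod_iff hmeas.aestronglyMeasurable).2 ⟨.of_forall fun η => ?_, ?_⟩
    · exact (hkint η).ofReal.smul (Real.fourierChar (inner ℝ η z) : ℂ)
    · refine ((integrable_besselSymbol hs).const_mul (Real.Gamma (s / 2))).congr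
        (.of_forall fun η => ?_)
      refine (besselSymbol_eq_integral hs0 η).trans ?_
      refine setIntegral_congr_fun measurableSet_Ioi fun t ht => ?_
      simp only [Function.uncurry_apply_pair, G, Circle.norm_smul, Complex.norm_real]
      exact (Real.norm_of_nonneg (hk0 η t ht)).symm
  have hswap := integral_integral_swap hG
  have hL : ∫ η, ∫ t in Set.Ioi (0 : ℝ), G η t =
      (Real.Gamma (s / 2) : ℂ) * 𝓕⁻ (fun η : E => (besselSymbol s η : ℂ)) z := by
    rw [Real.fourierInv_eq, ← integral_const_mul]
    refine integral_congr_ae (.of_forall fun η => ?_)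
    simp only [G, Circle.smul_def, smul_eq_mul]
    rw [integral_const_mul, integral_complex_ofReal, ← besselSymbol_eq_integral hs0]
    push_cast
    ring
  have hR : ∫ t in Set.Ioi (0 : ℝ), ∫ η, G η t =
      (((4 * Real.pi) ^ (-(d / 2)) *
        subordinationIntegral (s / 2 - d / 2) (‖z‖ ^ 2 / 4) : ℝ) : ℂ) := by
    rw [subordinationIntegral, ← integral_const_mul, ← integral_complex_ofReal]
    refine setIntegral_congr_fun measurableSet_Ioi fun t ht => ?_
    have ht' : (0 : ℝ) < t := ht
    have h := fourierInv_gaussian_dilation ht' z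
    rw [Real.fourierInv_eq] at h
    have : ∀ η, G η t = ((t ^ (s / 2 - 1) * Real.exp (-t) : ℝ) : ℂ) *
        (Real.fourierChar (inner ℝ η z) • (Real.exp (-(‖(2 * Real.pi) • η‖ ^ 2 * t)) : ℂ)) := by
      intro η
      have : k η t = t ^ (s / 2 - 1) * Real.exp (-t) *
          Real.exp (-(‖(2 * Real.pi) • η‖ ^ 2 * t)) := by
        rw [mul_assoc, ← Real.exp_add]
        simp only [k]
        congr 2
        ring
      simp only [G, this, Circle.smul_def, smul_eq_mul]
      push_cast
      ring
    simp only [this]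
    rw [integral_const_mul, h, ← Complex.ofReal_mul, ← hd]
    congr 1
    -- The factor `t^(-d/2)` of the transformed Gaussian lowers the parameter from `s/2` to `(s -
    -- d)/2`.
    rw [show s / 2 - d / 2 - 1 = (s / 2 - 1) + (-(d / 2)) by ring, Real.rpow_add ht',
      show -t - ‖z‖ ^ 2 / 4 / t = -t + -(‖z‖ ^ 2 / 4) / t by ring, Real.exp_add]
    ring
  rw [hL, hR] at hswap
  have hΓ' : (Real.Gamma (s / 2) : ℂ) ≠ 0 := Complex.ofReal_ne_zero.2 hΓ.ne'
  rw [div_mul_eq_mul_div, Complex.ofReal_div, ← hswap, mul_div_cancel_left₀ _ hΓ']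

end Subordination

/-! ### The two base values, from explicit transforms on the line. -/

section LineTransform

theorem integrable_one_add_mul_abs_mul_exp_neg_abs {q : ℝ} (hq : 0 ≤ q) :
    Integrable fun x : ℝ => (1 + q * |x|) * Real.exp (-|x|) := by
  -- The constant is `10 = 0! + 1! + 2! + 3!`: each `y^k` is at most `k! e^y`, and `(1 + y)(1 + y²)`
  -- is the sum of the powers up to `y³`.
  refine ((integrable_inv_one_add_sq).const_mul (10 * (1 + q))).mono'
    (Continuous.aestronglyMeasurable (by fun_prop)) (.of_forall fun x => ?_)
  rw [Real.norm_of_nonneg (by positivity), ← sq_abs x]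
  set y := |x|
  have hy : 0 ≤ y := abs_nonneg x
  have h1 := Real.pow_div_factorial_le_exp y hy 1
  have h2 := Real.pow_div_factorial_le_exp y hy 2
  have h3 := Real.pow_div_factorial_le_exp y hy 3
  have h0 := Real.one_le_exp hy
  norm_num [Nat.factorial] at h1 h2 h3
  rw [Real.exp_neg, ← div_eq_mul_inv, ← div_eq_mul_inv, div_le_div_iff₀ (by positivity)
    (by positivity)]
  have h4 : (1 + y) * (1 + y ^ 2) ≤ 10 * Real.exp y := by nlinarith
  have h5 : 1 + q * y ≤ (1 + q) * (1 + y) := by nlinarith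
  calc (1 + q * y) * (1 + y ^ 2) ≤ (1 + q) * (1 + y) * (1 + y ^ 2) := by gcongr
    _ = (1 + q) * ((1 + y) * (1 + y ^ 2)) := by ring
    _ ≤ (1 + q) * (10 * Real.exp y) := by gcongr
    _ = 10 * (1 + q) * Real.exp y := by ring

theorem integral_Ioi_one_add_mul_mul_cexp {z q : ℂ} (hz : 0 < z.re)
    (hint : IntegrableOn (fun x : ℝ => (1 + q * x) * Complex.exp (-(z * x))) (Set.Ioi 0)) :
    ∫ x in Set.Ioi (0 : ℝ), (1 + q * x) * Complex.exp (-(z * x)) = 1 / z + q / z ^ 2 := by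
  have hz0 : z ≠ 0 := fun h => by simp [h] at hz
  have key := integral_Ioi_of_hasDerivAt_of_tendsto' (a := 0) (m := 0)
    (f := fun x : ℝ => -((1 + q * x) / z + q / z ^ 2) * Complex.exp (-(z * x)))
    (f' := fun x : ℝ => (1 + q * x) * Complex.exp (-(z * x))) ?_ hint ?_
  · rw [key]
    simp
  · intro x _
    have hx : HasDerivAt (fun x : ℝ => (x : ℂ)) 1 x := Complex.ofRealCLM.hasDerivAt
    have h1 := (((((hx.const_mul q).const_add 1).div_const z).add_const (q / z ^ 2)).neg).mul
      ((hx.const_mul z).neg.cexp)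
    convert! h1 using 1
    simp only [Pi.neg_apply]
    field_simp
    ring
  · have e0 : Filter.Tendsto (fun x : ℝ => Complex.exp (-(z * x))) Filter.atTop (nhds 0) := by
      rw [tendsto_zero_iff_norm_tendsto_zero]
      have h := tendsto_rpow_mul_exp_neg_mul_atTop_nhds_zero 0 z.re hz
      refine h.congr fun x => ?_
      rw [Complex.norm_exp]
      simp
    have e1 : Filter.Tendsto (fun x : ℝ => (x : ℂ) * Complex.exp (-(z * x))) Filter.atTop
        (nhds 0) := by
      rw [tendsto_zero_iff_norm_tendsto_zero]
      have h := tendsto_rpow_mul_exp_neg_mul_atTop_nhds_zero 1 z.re hz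
      refine h.congr' ?_
      filter_upwards [Filter.eventually_ge_atTop 0] with x hx
      rw [norm_mul, Complex.norm_exp, Complex.norm_real, Real.norm_of_nonneg hx]
      simp
    have h := (e0.const_mul (-(1 / z + q / z ^ 2))).add (e1.const_mul (-(q / z)))
    simp only [mul_zero, add_zero] at h
    refine h.congr fun x => ?_
    ring

/-- Splitting at `0` gives Laplace integrals at `1 ± iθ`, with `θ = 2πη`. The sum is `2/(1 + θ²)`
for `q = 0` and collapses to `4/(1 + θ²)²` for `q = 1`: multiples of the symbols for `s = 2` and `s
= 4`. -/
theorem fourier_one_add_mul_abs_mul_exp_neg_abs {q : ℝ} (hq : 0 ≤ q) (η : ℝ) :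
    𝓕 (fun x : ℝ => (((1 + q * |x|) * Real.exp (-|x|) : ℝ) : ℂ)) η =
      (2 / (1 + (2 * Real.pi * η) ^ 2) +
        2 * q * (1 - (2 * Real.pi * η) ^ 2) / (1 + (2 * Real.pi * η) ^ 2) ^ 2 : ℝ) := by
  set θ := 2 * Real.pi * η with hθ
  let h : ℝ → ℂ := fun x => Complex.exp (-(θ * Complex.I * x)) *
    (((1 + q * |x|) * Real.exp (-|x|) : ℝ) : ℂ)
  have hh : Integrable h := by
    refine (integrable_one_add_mul_abs_mul_exp_neg_abs hq).mono'
      (Continuous.aestronglyMeasurable (by fun_prop)) (.of_forall fun x => ?_)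
    rw [norm_mul, Complex.norm_real, Real.norm_of_nonneg (by positivity), Complex.norm_exp]
    simp
  have hF : 𝓕 (fun x : ℝ => (((1 + q * |x|) * Real.exp (-|x|) : ℝ) : ℂ)) η = ∫ x, h x := by
    rw [Real.fourier_eq']
    refine integral_congr_ae (.of_forall fun x => ?_)
    simp only [h, smul_eq_mul, hθ]
    congr 2
    simp
    ring
  have hp : ∀ x ∈ Set.Ioi (0 : ℝ), h x =
      (1 + q * x) * Complex.exp (-((1 + θ * Complex.I) * x)) := fun x hx => by
    simp only [h]
    rw [abs_of_pos hx, show -((1 + θ * Complex.I) * x) = -(θ * Complex.I * x) + -(x : ℂ) by ring,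
      Complex.exp_add]
    push_cast
    ring
  have hn : ∀ x ∈ Set.Ioi (0 : ℝ), h (-x) =
      (1 + q * x) * Complex.exp (-((1 - θ * Complex.I) * x)) := fun x hx => by
    simp only [h]
    rw [abs_neg, abs_of_pos hx,
      show -((1 - θ * Complex.I) * x) = -(θ * Complex.I * ((-x : ℝ) : ℂ)) + -(x : ℂ) by
        push_cast; ring, Complex.exp_add]
    push_cast
    ring
  have ip := hh.integrableOn.congr_fun (s := Set.Ioi 0) hp measurableSet_Ioi
  have im := hh.comp_neg.integrableOn.congr_fun (s := Set.Ioi 0) hn measurableSet_Ioi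
  have hsplit : ∫ x, h x = (∫ x in Set.Ioi (0 : ℝ), h (-x)) + ∫ x in Set.Ioi (0 : ℝ), h x := by
    rw [integral_comp_neg_Ioi, neg_zero,
      intervalIntegral.integral_Iic_add_Ioi hh.integrableOn hh.integrableOn]
  rw [hF, hsplit, setIntegral_congr_fun measurableSet_Ioi hp,
    setIntegral_congr_fun measurableSet_Ioi hn,
    integral_Ioi_one_add_mul_mul_cexp (by simp) ip, integral_Ioi_one_add_mul_mul_cexp (by simp) im]
  have n1 : (1 + θ * Complex.I : ℂ) ≠ 0 := fun h => by simpa using congrArg Complex.re h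
  have n2 : (1 - θ * Complex.I : ℂ) ≠ 0 := fun h => by simpa using congrArg Complex.re h
  have n3 : (1 + (θ : ℂ) ^ 2) = (1 + θ * Complex.I) * (1 - θ * Complex.I) := by
    linear_combination (θ : ℂ) ^ 2 * Complex.I_sq
  push_cast
  rw [n3]
  field_simp
  linear_combination (2 * θ ^ 2 * q : ℂ) * Complex.I_sq

theorem besselSymbol_two_mul_natCast (A : ℕ) (η : ℝ) :
    besselSymbol (2 * (A : ℝ)) η = ((1 + (2 * Real.pi * η) ^ 2) ^ A)⁻¹ := by
  rw [besselSymbol, mul_div_cancel_left₀ _ two_ne_zero, Real.rpow_neg (by positivity),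
    Real.rpow_natCast, smul_eq_mul, Real.norm_eq_abs, sq_abs]

theorem fourierInv_besselSymbol_of_fourier_eq {f : ℝ → ℂ} {c s : ℝ} (hf : Continuous f)
    (hfi : Integrable f) (hs : 1 < s) (hc : c ≠ 0)
    (h : ∀ η, 𝓕 f η = (c * besselSymbol s η : ℝ)) (x : ℝ) :
    𝓕⁻ (fun η : ℝ => (besselSymbol s η : ℂ)) x = f x / c := by
  have hF : 𝓕 f = fun η => ((c * besselSymbol s η : ℝ) : ℂ) := funext h
  have hi : Integrable (𝓕 f) := by
    rw [hF]
    exact ((integrable_besselSymbol (by simpa using hs)).const_mul c).ofReal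
  have key := congrFun (hf.fourierInv_fourier_eq hfi hi) x
  rw [eq_div_iff (Complex.ofReal_ne_zero.2 hc), ← key, hF, Real.fourierInv_eq, Real.fourierInv_eq,
    ← integral_mul_const]
  refine integral_congr_ae (.of_forall fun η => ?_)
  simp only [Circle.smul_def, smul_eq_mul]
  push_cast
  ring

theorem fourierInv_besselSymbol_two (x : ℝ) :
    𝓕⁻ (fun η : ℝ => (besselSymbol 2 η : ℂ)) x = (Real.exp (-|x|) / 2 : ℝ) := by
  have h := fourierInv_besselSymbol_of_fourier_eq (s := 2) (c := 2)
    (f := fun x : ℝ => (((1 + 0 * |x|) * Real.exp (-|x|) : ℝ) : ℂ))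
    (by fun_prop) (integrable_one_add_mul_abs_mul_exp_neg_abs le_rfl).ofReal one_lt_two two_ne_zero
    (fun η => ?_) x
  · rw [h]
    push_cast
    ring
  · rw [fourier_one_add_mul_abs_mul_exp_neg_abs le_rfl]
    have := besselSymbol_two_mul_natCast 1 η
    norm_num at this
    rw [this]
    congr 1
    ring

theorem fourierInv_besselSymbol_four (x : ℝ) :
    𝓕⁻ (fun η : ℝ => (besselSymbol 4 η : ℂ)) x = ((1 + |x|) * Real.exp (-|x|) / 4 : ℝ) := by
  have h := fourierInv_besselSymbol_of_fourier_eq (s := 4) (c := 4)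
    (f := fun x : ℝ => (((1 + 1 * |x|) * Real.exp (-|x|) : ℝ) : ℂ))
    (by fun_prop) (integrable_one_add_mul_abs_mul_exp_neg_abs zero_le_one).ofReal (by norm_num)
    four_ne_zero (fun η => ?_) x
  · rw [h]
    push_cast
    ring
  · rw [fourier_one_add_mul_abs_mul_exp_neg_abs zero_le_one]
    have := besselSymbol_two_mul_natCast 2 η
    norm_num at this
    rw [this]
    congr 1
    have : 1 + (2 * Real.pi * η) ^ 2 ≠ 0 := by positivity
    field_simp
    ring

theorem four_mul_pi_rpow_neg_half : (4 * Real.pi) ^ (-(1 / 2 : ℝ)) = (2 * √Real.pi)⁻¹ := by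
  rw [Real.rpow_neg (by positivity), ← Real.sqrt_eq_rpow, Real.sqrt_mul (by norm_num),
    show (4 : ℝ) = 2 ^ 2 by norm_num, Real.sqrt_sq (by norm_num)]

/-- The subordination formula is read backwards: on the line with `s = 2` its left side is already
known, which determines the integral. -/
theorem subordinationIntegral_half {r : ℝ} (hr : 0 ≤ r) :
    subordinationIntegral (1 / 2) (r ^ 2 / 4) = √Real.pi * Real.exp (-r) := by
  have h := fourierInv_besselSymbol (E := ℝ) (s := 2) (by simp) r
  rw [fourierInv_besselSymbol_two, Complex.ofReal_inj, Module.finrank_self, Nat.cast_one,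
    four_mul_pi_rpow_neg_half, Real.norm_of_nonneg hr, abs_of_nonneg hr] at h
  norm_num at h
  have : 0 < √Real.pi := Real.sqrt_pos.2 Real.pi_pos
  field_simp at h
  linarith

/-- The same with `s = 4` on the line. The value depends on no dimension and then serves in all of
them. -/
theorem subordinationIntegral_three_halves {r : ℝ} (hr : 0 ≤ r) :
    subordinationIntegral (3 / 2) (r ^ 2 / 4) = √Real.pi / 2 * ((1 + r) * Real.exp (-r)) := by
  have h := fourierInv_besselSymbol (E := ℝ) (s := 4) (by norm_num) r
  rw [fourierInv_besselSymbol_four, Complex.ofReal_inj, Module.finrank_self, Nat.cast_one,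
    four_mul_pi_rpow_neg_half, Real.norm_of_nonneg hr, abs_of_nonneg hr] at h
  norm_num at h
  have : 0 < √Real.pi := Real.sqrt_pos.2 Real.pi_pos
  field_simp at h
  linarith

end LineTransform

/-! ### Half-integer parameters and reverse Bessel polynomials. -/

section ClosedForm

/-- The reverse Bessel polynomials, up to normalisation. -/
noncomputable def reverseBessel (A : ℕ) (r : ℝ) : ℝ :=
  ∑ k ∈ Finset.range A, ((A + k - 1).factorial : ℝ) /
    ((k.factorial : ℝ) * ((A - k - 1).factorial : ℝ)) * (r ^ (A - 1 - k) / 2 ^ k)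

theorem reverseBessel_succ (n : ℕ) (r : ℝ) :
    reverseBessel (n + 1) r = ∑ k ∈ Finset.range (n + 1), ((n + k).factorial : ℝ) /
      ((k.factorial : ℝ) * ((n - k).factorial : ℝ)) * (r ^ (n - k) / 2 ^ k) := by
  refine Finset.sum_congr rfl fun k _ => ?_
  rw [show n + 1 + k - 1 = n + k by lia, show n + 1 - k - 1 = n - k by lia,
    show n + 1 - 1 - k = n - k by lia]

theorem reverseBessel_recurrence (n : ℕ) (r : ℝ) :
    reverseBessel (n + 3) r =
      (2 * n + 3) * reverseBessel (n + 2) r + r ^ 2 * reverseBessel (n + 1) r := by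
  -- Coefficients are matched by powers of `r`: term `k + 1` on the left meets term `k` of the
  -- middle sum and term `k + 1` of the last. The ends are split off so that all three sums run over
  -- `range n`.
  rw [reverseBessel_succ, reverseBessel_succ, reverseBessel_succ, Finset.sum_range_succ',
    Finset.sum_range_succ _ (n + 1), Finset.sum_range_succ _ n, Finset.sum_range_succ _ (n + 1),
    Finset.sum_range_succ _ n, Finset.sum_range_succ' _ n]
  have hsum : ∑ k ∈ Finset.range n, ((n + 2 + (k + 1)).factorial : ℝ) /
      (((k + 1).factorial : ℝ) * ((n + 2 - (k + 1)).factorial : ℝ)) *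
        (r ^ (n + 2 - (k + 1)) / 2 ^ (k + 1)) =
      (2 * n + 3) * ∑ k ∈ Finset.range n, ((n + 1 + k).factorial : ℝ) /
      ((k.factorial : ℝ) * ((n + 1 - k).factorial : ℝ)) * (r ^ (n + 1 - k) / 2 ^ k) +
      r ^ 2 * ∑ k ∈ Finset.range n, ((n + (k + 1)).factorial : ℝ) /
      (((k + 1).factorial : ℝ) * ((n - (k + 1)).factorial : ℝ)) *
        (r ^ (n - (k + 1)) / 2 ^ (k + 1)) := by
    rw [Finset.mul_sum, Finset.mul_sum, ← Finset.sum_add_distrib]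
    refine Finset.sum_congr rfl fun k hk => ?_
    obtain ⟨m, rfl⟩ := Nat.exists_eq_add_of_lt (Finset.mem_range.1 hk)
    rw [show k + m + 1 + 2 + (k + 1) = (2 * k + m + 1) + 1 + 1 + 1 by lia,
      show k + m + 1 + 2 - (k + 1) = m + 1 + 1 by lia,
      show k + m + 1 + 1 + k = (2 * k + m + 1) + 1 by lia,
      show k + m + 1 + 1 - k = m + 1 + 1 by lia,
      show k + m + 1 + (k + 1) = (2 * k + m + 1) + 1 by lia,
      show k + m + 1 - (k + 1) = m by lia]
    simp only [Nat.factorial_succ (_ + 1), Nat.factorial_succ k, Nat.factorial_succ m]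
    push_cast
    field_simp
    ring
  rw [hsum, show n + 2 + (n + 1) = 2 * n + 1 + 1 + 1 by lia,
    show n + 2 + (n + 1 + 1) = 2 * n + 1 + 1 + 1 + 1 by lia,
    show n + 2 - (n + 1) = 1 by lia, show n + 2 - (n + 1 + 1) = 0 by lia,
    show n + 1 + n = 2 * n + 1 by lia, show n + 1 + (n + 1) = 2 * n + 1 + 1 by lia,
    show n + 1 - n = 1 by lia, show n + 1 - (n + 1) = 0 by lia]
  simp only [Nat.factorial_succ (_ + 1), Nat.factorial_succ n, add_zero, Nat.sub_zero,
    Nat.factorial_zero, Nat.factorial_one, pow_zero, Nat.cast_one, one_mul, mul_one, div_one]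
  push_cast
  field_simp
  ring

/-- At `ν = n + 3/2` and `c = r²/4`, the factor `2^n` turns the recurrence from integration by parts
into `reverseBessel_recurrence`. -/
theorem subordinationIntegral_half_add {r : ℝ} (hr : 0 ≤ r) (n : ℕ) :
    subordinationIntegral (n + 1 / 2) (r ^ 2 / 4) =
      √Real.pi * Real.exp (-r) * reverseBessel (n + 1) r / 2 ^ n := by
  induction n using Nat.twoStepInduction with
  | zero =>
    rw [Nat.cast_zero, zero_add, subordinationIntegral_half hr]
    simp [reverseBessel]
  | one =>
    rw [show ((1 : ℕ) : ℝ) + 1 / 2 = 3 / 2 by norm_num, subordinationIntegral_three_halves hr]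
    simp [reverseBessel, Finset.sum_range_succ]
    ring
  | more n ih0 ih1 =>
    have h := subordinationIntegral_add_one (ν := ((n + 1 : ℕ) : ℝ) + 1 / 2) (c := r ^ 2 / 4)
      (by push_cast; have : (0 : ℝ) ≤ n := n.cast_nonneg; linarith) (by positivity)
    rw [show ((n + 1 : ℕ) : ℝ) + 1 / 2 - 1 = n + 1 / 2 by push_cast; ring, ih0, ih1] at h
    rw [show ((n + 1 + 1 : ℕ) : ℝ) + 1 / 2 = ((n + 1 : ℕ) : ℝ) + 1 / 2 + 1 by push_cast; ring, h,
      reverseBessel_recurrence]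
    push_cast
    field_simp
    ring

end ClosedForm

/-! ### The explicit kernels and their constants. -/

theorem fourierInv_besselSymbol_add_three (n : ℕ) (z : EuclideanSpace ℝ (Fin n)) :
    𝓕⁻ (fun η : EuclideanSpace ℝ (Fin n) => (besselSymbol ((n : ℝ) + 3) η : ℂ)) z =
      ((1 / (2 ^ (n + 1) * Real.pi ^ (((n : ℝ) - 1) / 2) * Real.Gamma (((n : ℝ) + 3) / 2)) *
        Real.exp (-‖z‖) * (1 + ‖z‖) : ℝ) : ℂ) := by
  rw [fourierInv_besselSymbol (by simp), finrank_euclideanSpace_fin,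
    show ((n : ℝ) + 3) / 2 - n / 2 = 3 / 2 by ring,
    subordinationIntegral_three_halves (norm_nonneg z)]
  congr 1
  have hΓ : Real.Gamma (((n : ℝ) + 3) / 2) ≠ 0 :=
    (Real.Gamma_pos_of_pos (by positivity)).ne'
  have h1 : (4 * Real.pi) ^ (-((n : ℝ) / 2)) * √Real.pi =
      (2 ^ n * Real.pi ^ (((n : ℝ) - 1) / 2))⁻¹ := by
    rw [Real.mul_rpow (by norm_num) Real.pi_pos.le, Real.sqrt_eq_rpow, mul_assoc,
      ← Real.rpow_add Real.pi_pos, mul_inv, ← Real.rpow_neg Real.pi_pos.le]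
    congr 1
    · rw [show (4 : ℝ) = 2 ^ (2 : ℝ) by norm_num, ← Real.rpow_mul (by norm_num),
        ← Real.rpow_natCast, ← Real.rpow_neg (by norm_num)]
      congr 1
      ring
    · congr 1
      ring
  calc _ = (4 * Real.pi) ^ (-((n : ℝ) / 2)) * √Real.pi / (2 * Real.Gamma (((n : ℝ) + 3) / 2)) *
        ((1 + ‖z‖) * Real.exp (-‖z‖)) := by ring
    _ = _ := by
      rw [h1]
      have : Real.pi ^ (((n : ℝ) - 1) / 2) ≠ 0 := (Real.rpow_pos_of_pos Real.pi_pos _).ne'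
      field_simp
      ring

/-- The kernel of `H_{2A}(ℝ)` as a function of the distance. -/
noncomputable def lineKernel (A : ℕ) (a : ℝ) : ℝ :=
  Real.exp (-a) / (2 ^ A * ((A - 1).factorial : ℝ)) * reverseBessel A a

theorem finrank_lt_two_mul {A : ℕ} (hA : 1 ≤ A) : (Module.finrank ℝ ℝ : ℝ) < 2 * (A : ℝ) := by
  have : (1 : ℝ) ≤ A := by exact_mod_cast hA
  rw [Module.finrank_self, Nat.cast_one]
  linarith

theorem fourierInv_besselSymbol_two_mul {A : ℕ} (hA : 1 ≤ A) (z : ℝ) :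
    𝓕⁻ (fun η : ℝ => (besselSymbol (2 * (A : ℝ)) η : ℂ)) z = (lineKernel A ‖z‖ : ℂ) := by
  rw [fourierInv_besselSymbol (finrank_lt_two_mul hA)]
  obtain ⟨n, rfl⟩ := Nat.exists_eq_add_of_le' hA
  rw [Module.finrank_self,
    Nat.cast_one, four_mul_pi_rpow_neg_half, mul_div_cancel_left₀ _ two_ne_zero,
    show ((n + 1 : ℕ) : ℝ) - 1 / 2 = n + 1 / 2 by push_cast; ring,
    subordinationIntegral_half_add (norm_nonneg z), lineKernel, Nat.cast_succ,
    Real.Gamma_nat_eq_factorial, Nat.add_sub_cancel]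
  congr 1
  have : 0 < √Real.pi := Real.sqrt_pos.2 Real.pi_pos
  field_simp
  ring

theorem lineKernel_zero {A : ℕ} (hA : 1 ≤ A) :
    lineKernel A 0 = ((2 * A - 2).choose (A - 1) : ℝ) / 2 ^ (2 * A - 1) := by
  obtain ⟨n, rfl⟩ := Nat.exists_eq_add_of_le' hA
  -- At distance `0` only the constant term of the polynomial, `k = A - 1`, survives.
  rw [lineKernel, reverseBessel_succ, Finset.sum_range_succ, Finset.sum_eq_zero]
  · rw [show 2 * (n + 1) - 2 = n + n by lia, show 2 * (n + 1) - 1 = n + n + 1 by lia,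
      Nat.add_sub_cancel, Nat.add_choose]
    rw [Nat.cast_div (Nat.factorial_mul_factorial_dvd_factorial_add n n) (by positivity)]
    simp
    field_simp
    ring
  · intro k hk
    have : n - k ≠ 0 := by have := Finset.mem_range.1 hk; lia
    simp [this]

theorem integral_cexp_mul_one_add_sq_zpow {A : ℕ} (hA : 1 ≤ A) {a : ℝ} (ha : 0 ≤ a) :
    1 / (2 * (Real.pi : ℂ)) *
        ∫ ξ : ℝ, Complex.exp (Complex.I * a * ξ) * (1 + (ξ : ℂ) ^ 2) ^ (-(A : ℤ)) =
      (lineKernel A a : ℂ) := by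
  have h := fourierInv_besselSymbol_two_mul hA a
  rw [Real.norm_of_nonneg ha, Real.fourierInv_eq'] at h
  rw [← h]
  -- The substitution `ξ = 2πη` produces the prefactor `1/(2π)`.
  have hs := Measure.integral_comp_mul_left
    (fun ξ : ℝ => Complex.exp (Complex.I * a * ξ) * (1 + (ξ : ℂ) ^ 2) ^ (-(A : ℤ))) (2 * Real.pi)
  rw [abs_of_pos (by positivity), Complex.real_smul] at hs
  push_cast at hs
  rw [one_div, ← hs]
  refine integral_congr_ae (.of_forall fun η => ?_)
  simp only [besselSymbol_two_mul_natCast, smul_eq_mul, zpow_neg, zpow_natCast]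
  push_cast
  congr 2
  simp
  ring

theorem lemma3 :
    -- dimension `n`, `s = n + 3`
    (∀ (n : ℕ) (K : EuclideanSpace ℝ (Fin n) → EuclideanSpace ℝ (Fin n) → ℂ),
      (IsReproducingKernel ((n : ℝ) + 3)
          (sobolevSpace (EuclideanSpace ℝ (Fin n)) ((n : ℝ) + 3) : Set _) K ↔
        ∀ y x, K y x = ((1 / (2 ^ (n + 1) * Real.pi ^ (((n : ℝ) - 1) / 2) *
            Real.Gamma (((n : ℝ) + 3) / 2)) *
          Real.exp (-‖x - y‖) * (1 + ‖x - y‖) : ℝ) : ℂ)) ∧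
      (IsReproducingKernel ((n : ℝ) + 3)
          (realSobolevSpace (EuclideanSpace ℝ (Fin n)) ((n : ℝ) + 3)) K ↔
        ∀ y x, K y x = ((1 / (2 ^ (n + 1) * Real.pi ^ (((n : ℝ) - 1) / 2) *
            Real.Gamma (((n : ℝ) + 3) / 2)) *
          Real.exp (-‖x - y‖) * (1 + ‖x - y‖) : ℝ) : ℂ))) ∧
    -- dimension one, `s = 2 A`
    (∀ A : ℕ, 1 ≤ A →
      (∀ a : ℝ, 0 ≤ a →
        1 / (2 * (Real.pi : ℂ)) *
            ∫ ξ : ℝ, Complex.exp (Complex.I * a * ξ) * (1 + (ξ : ℂ) ^ 2) ^ (-(A : ℤ)) =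
          ((Real.exp (-a) / (2 ^ A * ((A - 1).factorial : ℝ)) *
            ∑ k ∈ Finset.range A, ((A + k - 1).factorial : ℝ) /
              ((k.factorial : ℝ) * ((A - k - 1).factorial : ℝ)) *
              (a ^ (A - 1 - k) / 2 ^ k) : ℝ) : ℂ)) ∧
      (∀ K : ℝ → ℝ → ℂ,
        (IsReproducingKernel (2 * (A : ℝ)) (sobolevSpace ℝ (2 * (A : ℝ)) : Set _) K ↔
          ∀ y x, K y x = ((Real.exp (-|x - y|) / (2 ^ A * ((A - 1).factorial : ℝ)) *
            ∑ k ∈ Finset.range A, ((A + k - 1).factorial : ℝ) /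
              ((k.factorial : ℝ) * ((A - k - 1).factorial : ℝ)) *
              (|x - y| ^ (A - 1 - k) / 2 ^ k) : ℝ) : ℂ)) ∧
        (IsReproducingKernel (2 * (A : ℝ)) (realSobolevSpace ℝ (2 * (A : ℝ))) K ↔
          ∀ y x, K y x = ((Real.exp (-|x - y|) / (2 ^ A * ((A - 1).factorial : ℝ)) *
            ∑ k ∈ Finset.range A, ((A + k - 1).factorial : ℝ) /
              ((k.factorial : ℝ) * ((A - k - 1).factorial : ℝ)) *
              (|x - y| ^ (A - 1 - k) / 2 ^ k) : ℝ) : ℂ)) ∧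
        (IsReproducingKernel (2 * (A : ℝ)) (sobolevSpace ℝ (2 * (A : ℝ)) : Set _) K →
          ∀ x, K x x = ((2 * A - 2).choose (A - 1) : ℂ) / 2 ^ (2 * A - 1)))) := by
  refine ⟨fun n K => ⟨?_, ?_⟩, fun A hA => ⟨fun a ha => ?_, fun K => ⟨?_, ?_, fun hK x => ?_⟩⟩⟩
  · exact isReproducingKernel_sobolevSpace_iff (κ := fun r => 1 / (2 ^ (n + 1) *
      Real.pi ^ (((n : ℝ) - 1) / 2) * Real.Gamma (((n : ℝ) + 3) / 2)) * Real.exp (-r) * (1 + r))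
      (by simp) (fourierInv_besselSymbol_add_three n) K
  · exact isReproducingKernel_realSobolevSpace_iff (κ := fun r => 1 / (2 ^ (n + 1) *
      Real.pi ^ (((n : ℝ) - 1) / 2) * Real.Gamma (((n : ℝ) + 3) / 2)) * Real.exp (-r) * (1 + r))
      (by simp) (fourierInv_besselSymbol_add_three n) K
  · exact integral_cexp_mul_one_add_sq_zpow hA ha
  · exact isReproducingKernel_sobolevSpace_iff (finrank_lt_two_mul hA)
      (fourierInv_besselSymbol_two_mul hA) K
  · exact isReproducingKernel_realSobolevSpace_iff (finrank_lt_two_mul hA)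
      (fourierInv_besselSymbol_two_mul hA) K
  · rw [(isReproducingKernel_sobolevSpace_iff (finrank_lt_two_mul hA)
      (fourierInv_besselSymbol_two_mul hA) K).1 hK x x, sub_self, norm_zero, lineKernel_zero hA]
    push_cast
    rfl
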